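/- Let $\mathcal H$ be a nonzero separable (possibly infinite-dimensional) complex Hilbert space, let $\mathcal L(\mathcal H)$ be its bounded operators and $\mathcal S(\mathcal H)$ its states, i.e. the positive trace-class operators of trace $1$. A POVM on a standard Borel space $\Omega$ is a map $M$ from the measurable subsets of $\Omega$ to the positive operators in $\mathcal L(\mathcal H)$ such that $X\mapsto \operatorname{tr}(\rho M(X))$ is a probability measure for every $\rho\in\mathcal S(\mathcal H)$; this measure is denoted $\operatorname{tr}(\rho M)$. A state $\rho_0$ is faithful if $A\ge 0$ and $\operatorname{tr}(\rho_0A)=0$ imply $A=0$. **Proposition.** Let $\mathcal S\subset\mathcal S(\mathcal H)$ be any set of states. Then the following are equivalent. 1. (Normal definition.) There exist a POVM $G$ on a standard Borel space $\Omega$ and a family of states $(\sigma_\lambda)_{\lambda\in\Omega}$, weakly measurable in the sense that $\lambda\mapsto\operatorname{tr}(\sigma_\lambda A)$ is measurable for every $A\in\mathcal L(\mathcal H)$, such that $$\operatorname{tr}(\rho M(X))=\int_\Omega \operatorname{tr}(\sigma_\lambda M(X))\,d(\operatorname{tr}(\rho G))(\lambda)$$ for every $\rho\in\mathcal S$, every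 POVM $M$ on a standard Borel space $\Omega_M$ and every measurable $X\subset\Omega_M$. 2. (Non-normal definition.) There exist a POVM $G$ on a standard Borel space $\Omega$, a faithful state $\rho_0$, and a positive linear map $T:\mathcal L(\mathcal H)\to L^\infty(\Omega,\operatorname{tr}(\rho_0G))$ with $T(I)=1$ (not assumed to be normal), such that $$\operatorname{tr}(\rho M(X))=\int_\Omega T(M(X))(\lambda)\,d(\operatorname{tr}(\rho G))(\lambda)$$ for every $\rho\in\mathcal S$, every POVM $M$ on a standard Borel space $\Omega_M$ and every measurable $X\subset\Omega_M$. -/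

import Mathlib

open MeasureTheory
open scoped ENNReal ComplexOrder InnerProductSpace

universe u v

noncomputable section

/-- The index set of a fixed orthonormal (Hilbert) basis of `H`. -/
def basisIndex (H : Type u) [NormedAddCommGroup H] [InnerProductSpace ℂ H] [CompleteSpace H] :
    Set H :=
  (exists_hilbertBasis ℂ H).choose

/-- A fixed orthonormal (Hilbert) basis of `H`. -/
def fixedBasis (H : Type u) [NormedAddCommGroup H] [InnerProductSpace ℂ H] [CompleteSpace H] :
    HilbertBasis (basisIndex H) ℂ H :=
  (exists_hilbertBasis ℂ H).choose_spec.choose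

/-- The trace `∑ᵢ ⟨eᵢ, T eᵢ⟩`. It is used only for trace-class `T`, for which the sum converges
absolutely and does not depend on the orthonormal basis. -/
def opTrace {H : Type u} [NormedAddCommGroup H] [InnerProductSpace ℂ H] [CompleteSpace H]
    (T : H →L[ℂ] H) : ℂ :=
  ∑' i, ⟪fixedBasis H i, T (fixedBasis H i)⟫_ℂ

/-- A quantum state (density operator): a positive trace-class operator of trace one.
For a positive operator, being trace class means that the diagonal sum converges. -/
structure DensityOperator (H : Type u) [NormedAddCommGroup H] [InnerProductSpace ℂ H]
    [CompleteSpace H] where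
  /-- The underlying bounded operator. -/
  op : H →L[ℂ] H
  isPositive : op.IsPositive
  trace_one : HasSum (fun i => ⟪fixedBasis H i, op (fixedBasis H i)⟫_ℂ) 1

/-- The expectation value `tr(ρ A)` of a bounded operator `A` in the state `ρ`. -/
def DensityOperator.expect {H : Type u} [NormedAddCommGroup H] [InnerProductSpace ℂ H]
    [CompleteSpace H] (ρ : DensityOperator H) (A : H →L[ℂ] H) : ℂ :=
  opTrace (ρ.op ∘L A)

/-- A state `ρ` is faithful if `A ≥ 0` and `tr(ρ A) = 0` imply `A = 0`. -/
def DensityOperator.Faithful {H : Type u} [NormedAddCommGroup H] [InnerProductSpace ℂ H]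
    [CompleteSpace H] (ρ : DensityOperator H) : Prop :=
  ∀ A : H →L[ℂ] H, A.IsPositive → ρ.expect A = 0 → A = 0

/-- A positive operator-valued measure on `Ω`: every measurable set gets a positive bounded
operator, and `X ↦ tr(ρ M(X))` is a probability measure for every state `ρ`. The values on
non-measurable sets carry no meaning and are never used. -/
structure POVM (Ω : Type v) [MeasurableSpace Ω] (H : Type u) [NormedAddCommGroup H]
    [InnerProductSpace ℂ H] [CompleteSpace H] where
  /-- The effect assigned to a set of outcomes. -/
  effect : Set Ω → (H →L[ℂ] H)
  isPositive : ∀ X, MeasurableSet X → (effect X).IsPositive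
  exists_measure : ∀ ρ : DensityOperator H, ∃ μ : Measure Ω, IsProbabilityMeasure μ ∧
    ∀ X, MeasurableSet X → ρ.expect (effect X) = ((μ.real X : ℝ) : ℂ)

/-- The outcome distribution `X ↦ tr(ρ M(X))`, as a measure on `Ω`. -/
def POVM.born {Ω : Type v} [MeasurableSpace Ω] {H : Type u} [NormedAddCommGroup H]
    [InnerProductSpace ℂ H] [CompleteSpace H] (M : POVM Ω H) (ρ : DensityOperator H) :
    Measure Ω :=
  (M.exists_measure ρ).choose

instance POVM.born_isProbabilityMeasure {Ω : Type v} [MeasurableSpace Ω] {H : Type u}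
    [NormedAddCommGroup H] [InnerProductSpace ℂ H] [CompleteSpace H] (M : POVM Ω H)
    (ρ : DensityOperator H) : IsProbabilityMeasure (M.born ρ) :=
  (M.exists_measure ρ).choose_spec.1

theorem POVM.expect_effect {Ω : Type v} [MeasurableSpace Ω] {H : Type u}
    [NormedAddCommGroup H] [InnerProductSpace ℂ H] [CompleteSpace H] (M : POVM Ω H)
    (ρ : DensityOperator H) {X : Set Ω} (hX : MeasurableSet X) :
    ρ.expect (M.effect X) = (((M.born ρ).real X : ℝ) : ℂ) :=
  (M.exists_measure ρ).choose_spec.2 X hX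

/-- The outcome distribution is the only measure with the values `tr(ρ M(X))`. -/
theorem POVM.eq_born {Ω : Type v} [MeasurableSpace Ω] {H : Type u}
    [NormedAddCommGroup H] [InnerProductSpace ℂ H] [CompleteSpace H] (M : POVM Ω H)
    (ρ : DensityOperator H) (μ : Measure Ω) [IsFiniteMeasure μ]
    (h : ∀ X, MeasurableSet X → ρ.expect (M.effect X) = ((μ.real X : ℝ) : ℂ)) :
    μ = M.born ρ := by
  ext X hX
  have h1 := (h X hX).symm.trans (M.expect_effect ρ hX)
  have h2 : μ.real X = (M.born ρ).real X := by exact_mod_cast h1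
  exact (measureReal_eq_measureReal_iff).1 h2

/-- A measurement response for `G` relative to the state `ρ₀` (which is taken faithful below):
a positive unital linear map from the bounded operators to `L^∞(Ω, tr(ρ₀ G))`. -/
structure MeasurementResponse {Ω : Type v} [MeasurableSpace Ω] {H : Type u}
    [NormedAddCommGroup H] [InnerProductSpace ℂ H] [CompleteSpace H] (G : POVM Ω H)
    (ρ₀ : DensityOperator H) where
  /-- The underlying linear map. -/
  toLinearMap : (H →L[ℂ] H) →ₗ[ℂ] Lp ℂ ∞ (G.born ρ₀)
  positive : ∀ A : H →L[ℂ] H, A.IsPositive → ∀ᵐ ω ∂(G.born ρ₀), 0 ≤ toLinearMap A ω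
  unital : ∀ᵐ ω ∂(G.born ρ₀), toLinearMap (ContinuousLinearMap.id ℂ H) ω = 1

/-- The set `S` of states is contextuality non-confirming (for all measurements) in the normal
sense: there are a POVM `G` on a standard Borel space and a weakly measurable family of states
`σ_ω` with `tr(ρ M(X)) = ∫ tr(σ_ω M(X)) d tr(ρ G(ω))` for every state `ρ` in `S`, every POVM `M`
on a standard Borel space and every measurable set `X` of outcomes of `M`. -/
def NormalNonConfirming {H : Type u} [NormedAddCommGroup H] [InnerProductSpace ℂ H]
    [CompleteSpace H] (S : Set (DensityOperator H)) : Prop :=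
  ∃ (Ω : Type v) (_ : MeasurableSpace Ω) (_ : StandardBorelSpace Ω) (G : POVM Ω H)
    (σ : Ω → DensityOperator H),
    (∀ A : H →L[ℂ] H, Measurable fun ω => (σ ω).expect A) ∧
    ∀ ρ ∈ S, ∀ (Ω' : Type v) [MeasurableSpace Ω'] [StandardBorelSpace Ω'] (M : POVM Ω' H)
      (X : Set Ω'), MeasurableSet X →
      ρ.expect (M.effect X) = ∫ ω, (σ ω).expect (M.effect X) ∂(G.born ρ)

/-- The set `S` of states is contextuality non-confirming (for all measurements) in the
non-normal sense: there are a POVM `G` on a standard Borel space, a faithful state `ρ₀` and a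
measurement response `T` for `G` with `tr(ρ M(X)) = ∫ T(M(X))(ω) d tr(ρ G(ω))` for every state `ρ`
in `S`, every POVM `M` on a standard Borel space and every measurable set `X` of outcomes of `M`.
Since `tr(ρ G)` is absolutely continuous with respect to `tr(ρ₀ G)`, the integral does not depend
on the representative of the class `T(M(X))`. -/
def NonNormalNonConfirming {H : Type u} [NormedAddCommGroup H] [InnerProductSpace ℂ H]
    [CompleteSpace H] (S : Set (DensityOperator H)) : Prop :=
  ∃ (Ω : Type v) (_ : MeasurableSpace Ω) (_ : StandardBorelSpace Ω) (G : POVM Ω H)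
    (ρ₀ : DensityOperator H) (_ : ρ₀.Faithful) (T : MeasurementResponse G ρ₀),
    ∀ ρ ∈ S, ∀ (Ω' : Type v) [MeasurableSpace Ω'] [StandardBorelSpace Ω'] (M : POVM Ω' H)
      (X : Set Ω'), MeasurableSet X →
      ρ.expect (M.effect X) = ∫ ω, T.toLinearMap (M.effect X) ω ∂(G.born ρ)

end

/-!
A normal response is in particular a response: a weakly measurable family of states `σ_ω` gives
`A ↦ [ω ↦ tr(σ_ω A)]` in `L^∞(Ω, tr(ρ₀ G))`, where `ρ₀` is any faithful state. A faithful state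
exists because the orthonormal basis is countable and nonempty, and `tr(ρ G) ≪ tr(ρ₀ G)` for every
`ρ` (`POVM.born_absolutelyContinuous`), so representatives may be exchanged under the integral.

Conversely, let `T` be a response that reproduces the probabilities in the states `ρ ∈ S`. Since
effects span the bounded operators, `tr(ρ A) = ∫ T(A) d tr(ρ G)` for all bounded `A`. Only the
values of `T` on the finite-rank operators are kept: for almost every `ω` the matrix
`tᵢⱼ(ω) = T(|eⱼ⟩⟨eᵢ|)(ω)` is positive semidefinite with trace at most one
(`MeasurementResponse.ae_isPositive_matrixTruncation`,
`MeasurementResponse.ae_normalMass_le_one`). A positive semidefinite matrix of trace one is the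
matrix of a state (`exists_densityOperator_of_matrix`). The trace need not be one for
`tr(ρ₀ G)`-almost every `ω`, because `T` may have a singular part, which vanishes on finite-rank
operators. But for `ρ ∈ S` the trace integrates to `∑ᵢ tr(ρ |eᵢ⟩⟨eᵢ|) = 1` against `tr(ρ G)`, so
being at most one it equals one `tr(ρ G)`-almost everywhere
(`MeasurementResponse.ae_normalMass_eq_one`). This gives a weakly measurable family of states
`σ_ω` with `tr(ρ K) = ∫ tr(σ_ω K) d tr(ρ G)` for `K` of finite rank. States are normal, so for
bounded `A` both sides are limits of their values at the compressions `P A P` to the finite sets of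
basis vectors (`DensityOperator.tendsto_expect_compression`), by dominated convergence.
-/

open Filter Topology InnerProductSpace

/-! ### The trace against a state -/

section Trace

theorem HilbertBasis.hasSum_norm_inner_sq {ι : Type*} {E : Type*} [NormedAddCommGroup E]
    [InnerProductSpace ℂ E] (b : HilbertBasis ι ℂ E)
    (x : E) : HasSum (fun i => ‖⟪b i, x⟫_ℂ‖ ^ 2) (‖x‖ ^ 2) := by
  have h := b.hasSum_inner_mul_inner x x
  have h2 := Complex.hasSum_re h
  convert h2 using 1
  · funext i
    rw [← inner_conj_symm x (b i), ← Complex.normSq_eq_conj_mul_self, Complex.ofReal_re,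
      Complex.normSq_eq_norm_sq]
  · rw [inner_self_eq_norm_sq_to_K]
    norm_cast

variable {H : Type u} [NormedAddCommGroup H] [InnerProductSpace ℂ H] [CompleteSpace H]

/-- Cyclicity of the trace in the form `tr(ρ A) = tr(√ρ A √ρ)`. With `rᵢ = √ρ eᵢ` the expectation
value becomes a norm-convergent convex combination of vector states, from which its linearity,
positivity and normality can be read off. -/
theorem DensityOperator.exists_hasSum_expect (ρ : DensityOperator H) :
    ∃ r : basisIndex H → H, HasSum (fun i => ‖r i‖ ^ 2) 1 ∧
      ∀ A : H →L[ℂ] H, HasSum (fun i => ⟪r i, A (r i)⟫_ℂ) (ρ.expect A) := by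
  set e := fixedBasis H
  have h0 : 0 ≤ ρ.op := (ContinuousLinearMap.nonneg_iff_isPositive _).2 ρ.isPositive
  set R : H →L[ℂ] H := CFC.sqrt ρ.op
  have hRR : R * R = ρ.op := CFC.sqrt_mul_sqrt_self ρ.op h0
  have hR : R.IsPositive :=
    (ContinuousLinearMap.nonneg_iff_isPositive _).1 (CFC.sqrt_nonneg ρ.op)
  have hop : ∀ x y, ⟪x, ρ.op y⟫_ℂ = ⟪R x, R y⟫_ℂ := fun x y => by
    rw [← hRR, mul_apply_eq_comp, hR.inner_left_eq_inner_right]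
  have hr : HasSum (fun i => ‖R (e i)‖ ^ 2) 1 := by
    have h := Complex.hasSum_re ρ.trace_one
    rw [Complex.one_re] at h
    convert h using 2 with i
    change _ = (⟪e i, ρ.op (e i)⟫_ℂ).re
    rw [hop, inner_self_eq_norm_sq_to_K]
    norm_cast
  refine ⟨fun i => R (e i), hr, fun A => ?_⟩
  have hHS : ∀ B : H →L[ℂ] H,
      Summable fun p : basisIndex H × basisIndex H => ‖⟪e p.2, B (R (e p.1))⟫_ℂ‖ ^ 2 := by
    intro B
    rw [summable_prod_of_nonneg (fun _ => sq_nonneg _)]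
    refine ⟨fun i => (e.hasSum_norm_inner_sq (B (R (e i)))).summable, ?_⟩
    simp only [(e.hasSum_norm_inner_sq _).tsum_eq]
    refine Summable.of_nonneg_of_le (fun _ => sq_nonneg _) (fun i => ?_)
      (hr.summable.mul_left (‖B‖ ^ 2))
    rw [← mul_pow]
    gcongr
    exact B.le_opNorm _
  -- The double series `∑ᵢⱼ ⟪A* R eⱼ, eᵢ⟫ ⟪eᵢ, R eⱼ⟫` converges absolutely, as both factors are
  -- square summable; its two iterated sums are the two sides.
  set f : basisIndex H × basisIndex H → ℂ := fun p =>
    ⟪ContinuousLinearMap.adjoint A (R (e p.1)), e p.2⟫_ℂ * ⟪e p.2, R (e p.1)⟫_ℂ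
  have hf : Summable f := by
    refine Summable.of_norm_bounded
      ((hHS (ContinuousLinearMap.adjoint A)).add (hHS (ContinuousLinearMap.id ℂ H))) fun p => ?_
    simp only [f, norm_mul, ContinuousLinearMap.id_apply]
    rw [norm_inner_symm]
    nlinarith [sq_nonneg (‖⟪e p.2, ContinuousLinearMap.adjoint A (R (e p.1))⟫_ℂ‖ -
      ‖⟪e p.2, R (e p.1)⟫_ℂ‖), sq_nonneg (‖⟪e p.2, ContinuousLinearMap.adjoint A (R (e p.1))⟫_ℂ‖ +
      ‖⟪e p.2, R (e p.1)⟫_ℂ‖)]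
  have h1 : HasSum (fun j => ⟪R (e j), A (R (e j))⟫_ℂ) (∑' p, f p) := by
    refine hf.hasSum.prod_fiberwise fun j => ?_
    have := e.hasSum_inner_mul_inner (ContinuousLinearMap.adjoint A (R (e j))) (R (e j))
    rwa [ContinuousLinearMap.adjoint_inner_left] at this
  have h2 : HasSum (fun i => ⟪e i, (ρ.op ∘L A) (e i)⟫_ℂ) (∑' p, f p) := by
    refine ((Equiv.prodComm _ _).hasSum_iff.2 hf.hasSum).prod_fiberwise fun i => ?_
    have := e.hasSum_inner_mul_inner (R (e i)) (R (A (e i)))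
    rw [← hop] at this
    refine this.congr_fun fun j => ?_
    simp only [f, Function.comp, Equiv.prodComm_apply, Prod.swap]
    rw [ContinuousLinearMap.adjoint_inner_left, ← hR.inner_left_eq_inner_right (e i) (e j),
      ← hR.inner_left_eq_inner_right (e j) (A (e i)), mul_comm]
  rw [DensityOperator.expect, opTrace, h2.tsum_eq]
  exact h1

theorem DensityOperator.expect_add (ρ : DensityOperator H) (A B : H →L[ℂ] H) :
    ρ.expect (A + B) = ρ.expect A + ρ.expect B := by
  obtain ⟨r, -, h⟩ := ρ.exists_hasSum_expect
  refine (h _).unique ?_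
  simpa [inner_add_right] using (h A).add (h B)

theorem DensityOperator.expect_smul (ρ : DensityOperator H) (c : ℂ) (A : H →L[ℂ] H) :
    ρ.expect (c • A) = c * ρ.expect A := by
  obtain ⟨r, -, h⟩ := ρ.exists_hasSum_expect
  refine (h _).unique ?_
  simpa [inner_smul_right] using (h A).mul_left c

/-- The expectation value as a linear functional of the observable. -/
noncomputable def DensityOperator.expectₗ (ρ : DensityOperator H) : (H →L[ℂ] H) →ₗ[ℂ] ℂ where
  toFun := ρ.expect
  map_add' := ρ.expect_add
  map_smul' := ρ.expect_smul

theorem DensityOperator.expectₗ_apply (ρ : DensityOperator H) (A : H →L[ℂ] H) :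
    ρ.expectₗ A = ρ.expect A := rfl

theorem DensityOperator.expect_nonneg (ρ : DensityOperator H) {A : H →L[ℂ] H}
    (hA : A.IsPositive) : 0 ≤ ρ.expect A := by
  obtain ⟨r, -, h⟩ := ρ.exists_hasSum_expect
  exact (h A).nonneg fun i => hA.inner_nonneg_right _

theorem DensityOperator.norm_expect_le (ρ : DensityOperator H) (A : H →L[ℂ] H) :
    ‖ρ.expect A‖ ≤ ‖A‖ := by
  obtain ⟨r, h1, h⟩ := ρ.exists_hasSum_expect
  rw [← (h A).tsum_eq]
  have := h1.mul_left ‖A‖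
  rw [mul_one] at this
  refine tsum_of_norm_bounded this fun i => ?_
  calc _ ≤ ‖r i‖ * ‖A (r i)‖ := norm_inner_le_norm _ _
    _ ≤ ‖r i‖ * (‖A‖ * ‖r i‖) := by gcongr; exact A.le_opNorm _
    _ = _ := by ring

theorem DensityOperator.expect_id (ρ : DensityOperator H) :
    ρ.expect (ContinuousLinearMap.id ℂ H) = 1 := by
  simpa [DensityOperator.expect, opTrace] using ρ.trace_one.tsum_eq

theorem DensityOperator.expect_rankOne (ρ : DensityOperator H) (i j : basisIndex H) :
    ρ.expect (rankOne ℂ (fixedBasis H j) (fixedBasis H i)) =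
      ⟪fixedBasis H i, ρ.op (fixedBasis H j)⟫_ℂ := by
  classical
  rw [DensityOperator.expect, opTrace, tsum_eq_single i]
  · simp [(fixedBasis H).orthonormal.1 i]
  · intro k hk
    simp [orthonormal_iff_ite.1 (fixedBasis H).orthonormal i k, hk.symm]

/-- The orthogonal projection onto the span of finitely many vectors of the fixed basis. -/
noncomputable def basisProj (F : Finset (basisIndex H)) : H →L[ℂ] H :=
  ∑ i ∈ F, rankOne ℂ (fixedBasis H i) (fixedBasis H i)

theorem basisProj_apply (F : Finset (basisIndex H)) (x : H) :
    basisProj F x = ∑ i ∈ F, ⟪fixedBasis H i, x⟫_ℂ • fixedBasis H i := by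
  simp [basisProj]

theorem tendsto_basisProj (x : H) :
    Tendsto (fun F : Finset (basisIndex H) => basisProj F x) atTop (𝓝 x) := by
  simp only [basisProj_apply]
  simpa [HasSum, HilbertBasis.repr_apply_apply] using (fixedBasis H).hasSum_repr x

theorem isPositive_basisProj (F : Finset (basisIndex H)) :
    (basisProj F : H →L[ℂ] H).IsPositive :=
  ContinuousLinearMap.isPositive_sum _ fun _ _ => isPositive_rankOne_self _

theorem basisProj_mul_self (F : Finset (basisIndex H)) :
    (basisProj F : H →L[ℂ] H) * basisProj F = basisProj F := by
  classical
  ext x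
  rw [mul_apply_eq_comp, basisProj_apply F x, map_sum]
  refine Finset.sum_congr rfl fun i hi => ?_
  rw [map_smul, basisProj_apply]
  simp [orthonormal_iff_ite.1 (fixedBasis H).orthonormal, hi]

theorem isStarProjection_basisProj (F : Finset (basisIndex H)) :
    IsStarProjection (basisProj F : H →L[ℂ] H) :=
  ⟨basisProj_mul_self F, (isPositive_basisProj F).isSelfAdjoint⟩

theorem isPositive_id_sub_basisProj (F : Finset (basisIndex H)) :
    (ContinuousLinearMap.id ℂ H - basisProj F).IsPositive :=
  .of_isStarProjection (isStarProjection_basisProj F).one_sub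

theorem norm_basisProj_apply_le (F : Finset (basisIndex H)) (x : H) :
    ‖basisProj F x‖ ≤ ‖x‖ := by
  simpa using (basisProj F).le_of_opNorm_le (isStarProjection_basisProj F).norm_le x

/-- The compression of a bounded operator to the span of finitely many basis vectors. -/
noncomputable def compression (F : Finset (basisIndex H)) (A : H →L[ℂ] H) : H →L[ℂ] H :=
  basisProj F * A * basisProj F

theorem compression_eq_sum (F : Finset (basisIndex H)) (A : H →L[ℂ] H) :
    compression F A = ∑ i ∈ F, ∑ j ∈ F, ⟪fixedBasis H i, A (fixedBasis H j)⟫_ℂ •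
      rankOne ℂ (fixedBasis H i) (fixedBasis H j) := by
  ext x
  simp only [compression, mul_apply_eq_comp, _root_.sum_apply, _root_.smul_apply, rankOne_apply]
  rw [basisProj_apply F (A _), basisProj_apply F x]
  refine Finset.sum_congr rfl fun i _ => ?_
  simp only [map_sum, map_smul, inner_sum, inner_smul_right, Finset.sum_smul, smul_smul]
  refine Finset.sum_congr rfl fun j _ => ?_
  rw [mul_comm]

theorem norm_compression_le (F : Finset (basisIndex H)) (A : H →L[ℂ] H) :
    ‖compression F A‖ ≤ ‖A‖ := by
  refine ContinuousLinearMap.opNorm_le_bound _ (norm_nonneg _) fun x => ?_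
  calc _ ≤ ‖A (basisProj F x)‖ := norm_basisProj_apply_le _ _
    _ ≤ ‖A‖ * ‖basisProj F x‖ := A.le_opNorm _
    _ ≤ _ := by gcongr; exact norm_basisProj_apply_le _ _

/-- Normality of states, in the only form that is needed: a state is determined by its values on
the finite-rank operators. -/
theorem DensityOperator.tendsto_expect_compression (ρ : DensityOperator H) (A : H →L[ℂ] H) :
    Tendsto (fun F => ρ.expect (compression F A)) atTop (𝓝 (ρ.expect A)) := by
  obtain ⟨r, h1, h⟩ := ρ.exists_hasSum_expect
  simp only [← (h _).tsum_eq]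
  refine tendsto_tsum_of_dominated_convergence (h1.summable.mul_left ‖A‖) (fun i => ?_)
    (.of_forall fun F i => ?_)
  · have h2 : ∀ F, ⟪r i, compression F A (r i)⟫_ℂ = ⟪basisProj F (r i), A (basisProj F (r i))⟫_ℂ :=
      fun F => ((isPositive_basisProj F).inner_left_eq_inner_right _ _).symm
    simp only [h2]
    exact (tendsto_basisProj _).inner ((A.continuous.tendsto _).comp (tendsto_basisProj _))
  · calc _ ≤ ‖r i‖ * ‖compression F A (r i)‖ := norm_inner_le_norm _ _
      _ ≤ ‖r i‖ * (‖A‖ * ‖r i‖) := by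
        gcongr
        exact ContinuousLinearMap.le_of_opNorm_le _ (norm_compression_le F A) _
      _ = _ := by ring

theorem countable_basisIndex [TopologicalSpace.SeparableSpace H] : Countable (basisIndex H) := by
  have h : ∀ i j : basisIndex H, i ≠ j → ‖fixedBasis H i - fixedBasis H j‖ = √2 := by
    intro i j hij
    rw [eq_comm, Real.sqrt_eq_iff_mul_self_eq (by norm_num) (norm_nonneg _),
      norm_sub_mul_self (𝕜 := ℂ)]
    simp [(fixedBasis H).orthonormal.1, (fixedBasis H).orthonormal.2 hij]
    norm_num
  have hd : Pairwise (Function.onFun Disjoint fun i => Metric.ball (fixedBasis H i) (1 / 2)) := by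
    intro i j hij
    refine Metric.ball_disjoint_ball ?_
    rw [dist_eq_norm, h i j hij, Real.le_sqrt] <;> norm_num
  exact hd.countable_of_isOpen_disjoint (fun _ => Metric.isOpen_ball)
    fun _ => Metric.nonempty_ball.2 (by norm_num)

end Trace

/-! ### States from positive semidefinite matrices -/

section Matrix

variable {H : Type u} [NormedAddCommGroup H] [InnerProductSpace ℂ H]

theorem ContinuousLinearMap.isPositive_of_inner_nonneg {T : H →L[ℂ] H}
    (h : ∀ x, 0 ≤ ⟪x, T x⟫_ℂ) : T.IsPositive := by
  rw [ContinuousLinearMap.isPositive_iff_complex]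
  intro x
  obtain ⟨h1, h2⟩ := Complex.nonneg_iff.1 (h x)
  have h3 : ⟪T x, x⟫_ℂ = ⟪x, T x⟫_ℂ := by
    rw [← inner_conj_symm]
    exact Complex.conj_eq_iff_im.2 h2.symm
  rw [h3]
  exact ⟨Complex.ext rfl (by simpa using h2), h1⟩

theorem ContinuousLinearMap.IsPositive.norm_inner_sq_le [CompleteSpace H] {T : H →L[ℂ] H}
    (hT : T.IsPositive) (x y : H) :
    ‖⟪x, T y⟫_ℂ‖ ^ 2 ≤ (⟪x, T x⟫_ℂ).re * (⟪y, T y⟫_ℂ).re := by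
  have h0 : 0 ≤ T := (ContinuousLinearMap.nonneg_iff_isPositive _).2 hT
  have hR : (CFC.sqrt T).IsPositive :=
    (ContinuousLinearMap.nonneg_iff_isPositive _).1 (CFC.sqrt_nonneg T)
  have hop : ∀ x y, ⟪x, T y⟫_ℂ = ⟪CFC.sqrt T x, CFC.sqrt T y⟫_ℂ := fun x y => by
    rw [hR.inner_left_eq_inner_right, ← mul_apply_eq_comp, CFC.sqrt_mul_sqrt_self T h0]
  have hre : ∀ z : H, (⟪z, z⟫_ℂ).re = ‖z‖ ^ 2 := fun z => inner_self_eq_norm_sq (𝕜 := ℂ) z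
  rw [hop, hop, hop, hre, hre, ← mul_pow]
  gcongr
  exact norm_inner_le_norm _ _

variable [CompleteSpace H]

/-- The finite-rank operator with the entries `t i j`, for `i` and `j` in `F`, with respect to the
fixed basis. -/
noncomputable def matrixTruncation (t : basisIndex H → basisIndex H → ℂ)
    (F : Finset (basisIndex H)) : H →L[ℂ] H :=
  ∑ i ∈ F, ∑ j ∈ F, t i j • rankOne ℂ (fixedBasis H i) (fixedBasis H j)

theorem inner_matrixTruncation (t : basisIndex H → basisIndex H → ℂ) (F : Finset (basisIndex H))
    (x : H) : ⟪x, matrixTruncation t F x⟫_ℂ =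
      ∑ i ∈ F, ∑ j ∈ F, t i j * (⟪x, fixedBasis H i⟫_ℂ * ⟪fixedBasis H j, x⟫_ℂ) := by
  simp only [matrixTruncation, _root_.sum_apply, _root_.smul_apply, rankOne_apply, inner_sum,
    inner_smul_right]
  exact Finset.sum_congr rfl fun i _ => Finset.sum_congr rfl fun j _ => by ring

theorem inner_matrixTruncation_basis (t : basisIndex H → basisIndex H → ℂ)
    {F : Finset (basisIndex H)} {i j : basisIndex H} (hi : i ∈ F) (hj : j ∈ F) :
    ⟪fixedBasis H i, matrixTruncation t F (fixedBasis H j)⟫_ℂ = t i j := by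
  classical
  simp [matrixTruncation, _root_.sum_apply,
    orthonormal_iff_ite.1 (fixedBasis H).orthonormal, hi, hj]

/-- A positive semidefinite infinite matrix of trace one is the matrix of a state. By the
Cauchy-Schwarz inequality `|tᵢⱼ|² ≤ tᵢᵢ tⱼⱼ`, so the columns `wⱼ` have `‖wⱼ‖² ≤ tⱼⱼ` and
`y ↦ ∑ⱼ ⟪eⱼ, y⟫ wⱼ` converges. -/
theorem exists_densityOperator_of_matrix [Countable (basisIndex H)]
    (t : basisIndex H → basisIndex H → ℂ) (hpos : ∀ F, (matrixTruncation t F).IsPositive)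
    (htr : HasSum (fun i => t i i) 1) :
    ∃ ρ : DensityOperator H, ∀ i j, ⟪fixedBasis H i, ρ.op (fixedBasis H j)⟫_ℂ = t i j := by
  classical
  set e := fixedBasis H with he
  have hcs : ∀ i j, ‖t i j‖ ^ 2 ≤ (t i i).re * (t j j).re := by
    intro i j
    have h := (hpos {i, j}).norm_inner_sq_le (e i) (e j)
    rwa [inner_matrixTruncation_basis t (by simp) (by simp),
      inner_matrixTruncation_basis t (by simp) (by simp),
      inner_matrixTruncation_basis t (by simp) (by simp)] at h
  have htr' : HasSum (fun i => (t i i).re) 1 := by simpa using Complex.hasSum_re htr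
  have hcol : ∀ j, HasSum (fun i => (t i i).re * (t j j).re) (t j j).re := fun j => by
    simpa using htr'.mul_right (t j j).re
  have hmem : ∀ j, Memℓp (fun i => t i j) 2 := fun j => by
    refine memℓp_gen ?_
    refine Summable.of_nonneg_of_le (fun _ => by positivity) (fun i => ?_) (hcol j).summable
    simpa using hcs i j
  set w : basisIndex H → H := fun j => e.repr.symm ⟨fun i => t i j, hmem j⟩ with hw
  have hew : ∀ i j, ⟪e i, w j⟫_ℂ = t i j := fun i j => by
    rw [← e.repr_apply_apply, hw]
    simp
  have hwn : ∀ j, ‖w j‖ ^ 2 ≤ (t j j).re := fun j => by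
    refine hasSum_le (fun i => ?_) (e.hasSum_norm_inner_sq (w j)) (hcol j)
    rw [hew]
    exact hcs i j
  have hsum : ∀ y : H, Summable fun j => ⟪e j, y⟫_ℂ • w j := fun y => by
    refine Summable.of_norm_bounded ((e.hasSum_norm_inner_sq y).summable.add htr'.summable)
      fun j => ?_
    rw [norm_smul]
    nlinarith [hwn j, sq_nonneg (‖⟪e j, y⟫_ℂ‖ - ‖w j‖), sq_nonneg (‖⟪e j, y⟫_ℂ‖ + ‖w j‖)]
  have hlim : Tendsto (fun (F : Finset (basisIndex H)) (y : H) =>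
      (∑ j ∈ F, rankOne ℂ (w j) (e j)) y) atTop (𝓝 fun y => ∑' j, ⟪e j, y⟫_ℂ • w j) := by
    rw [tendsto_pi_nhds]
    intro y
    simpa [HasSum, _root_.sum_apply] using (hsum y).hasSum
  set σ : H →L[ℂ] H := continuousLinearMapOfTendsto _ hlim with hσ
  have hσy : ∀ y, σ y = ∑' j, ⟪e j, y⟫_ℂ • w j := fun y => rfl
  have hσe : ∀ j, σ (e j) = w j := fun j => by
    rw [hσy, tsum_eq_single j]
    · simp [e.orthonormal.1 j]
    · intro k hk
      simp [e.orthonormal.2 hk]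
  have hent : ∀ i j, ⟪e i, σ (e j)⟫_ℂ = t i j := fun i j => by rw [hσe, hew]
  have hcomp : ∀ F, compression F σ = matrixTruncation t F := fun F => by
    rw [compression_eq_sum, matrixTruncation]
    exact Finset.sum_congr rfl fun i _ => Finset.sum_congr rfl fun j _ => by
      rw [← he, hent]
  have hσpos : σ.IsPositive := by
    refine ContinuousLinearMap.isPositive_of_inner_nonneg fun x => ?_
    have h1 : Tendsto (fun F => ⟪basisProj F x, σ (basisProj F x)⟫_ℂ) atTop (𝓝 ⟪x, σ x⟫_ℂ) :=
      (tendsto_basisProj x).inner ((σ.continuous.tendsto _).comp (tendsto_basisProj x))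
    refine ge_of_tendsto' h1 fun F => ?_
    rw [(isPositive_basisProj F).inner_left_eq_inner_right]
    change 0 ≤ ⟪x, compression F σ x⟫_ℂ
    rw [hcomp]
    exact (hpos F).inner_nonneg_right x
  exact ⟨⟨σ, hσpos, htr.congr_fun fun i => hent i i⟩, hent⟩

/-- On finite-rank operators the expectation value is a finite sum of matrix entries. -/
theorem DensityOperator.expect_compression (ρ : DensityOperator H) (F : Finset (basisIndex H))
    (A : H →L[ℂ] H) : ρ.expect (compression F A) =
      ∑ i ∈ F, ∑ j ∈ F, ⟪fixedBasis H i, A (fixedBasis H j)⟫_ℂ *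
        ⟪fixedBasis H j, ρ.op (fixedBasis H i)⟫_ℂ := by
  rw [compression_eq_sum, ← expectₗ_apply, map_sum]
  refine Finset.sum_congr rfl fun i _ => ?_
  rw [map_sum]
  refine Finset.sum_congr rfl fun j _ => ?_
  rw [map_smul, expectₗ_apply, expect_rankOne, smul_eq_mul]

theorem nonempty_basisIndex [Nontrivial H] : Nonempty (basisIndex H) := by
  by_contra hne
  rw [not_nonempty_iff] at hne
  obtain ⟨x, hx⟩ := exists_ne (0 : H)
  refine hx ?_
  have h := (fixedBasis H).hasSum_norm_inner_sq x
  have h0 := h.unique hasSum_empty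
  simpa using h0

/-- A faithful state exists: the diagonal one whose eigenvalues are summable and all positive. -/
theorem DensityOperator.exists_faithful [Countable (basisIndex H)] [Nontrivial H] :
    ∃ ρ : DensityOperator H, ρ.Faithful := by
  classical
  have := nonempty_basisIndex (H := H)
  set e := fixedBasis H with he
  have := Encodable.ofCountable (basisIndex H)
  obtain ⟨c', hc'pos, s, hs, -⟩ := posSumOfEncodable one_pos (basisIndex H)
  have hs0 : 0 < s := by
    obtain ⟨i⟩ := ‹Nonempty (basisIndex H)›
    exact (hc'pos i).trans_le (le_hasSum hs i fun _ _ => (hc'pos _).le)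
  set c : basisIndex H → ℝ := fun i => c' i / s
  have hc0 : ∀ i, 0 < c i := fun i => div_pos (hc'pos i) hs0
  have hc1 : HasSum c 1 := by simpa [div_self hs0.ne'] using hs.div_const s
  obtain ⟨ρ, hρ⟩ := exists_densityOperator_of_matrix (H := H)
    (fun i j => if i = j then (c i : ℂ) else 0) (fun F => by
      have : matrixTruncation (H := H) (fun i j => if i = j then (c i : ℂ) else 0) F =
          ∑ i ∈ F, (c i : ℂ) • rankOne ℂ (e i) (e i) := by
        refine Finset.sum_congr rfl fun i hi => ?_
        rw [Finset.sum_eq_single i] <;> simp +contextual [hi, eq_comm, e]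
      rw [this]
      exact ContinuousLinearMap.isPositive_sum _ fun i _ =>
        (isPositive_rankOne_self _).smul_of_nonneg (by exact_mod_cast (hc0 i).le))
    (by simpa using Complex.hasSum_ofReal.2 hc1)
  refine ⟨ρ, fun A hA h0 => ?_⟩
  have hsum : HasSum (fun i => (c i : ℂ) * ⟪e i, A (e i)⟫_ℂ) (ρ.expect A) := by
    refine (ρ.tendsto_expect_compression A).congr fun F => ?_
    rw [ρ.expect_compression]
    refine Finset.sum_congr rfl fun i hi => ?_
    rw [Finset.sum_eq_single i]
    · rw [hρ, if_pos rfl, mul_comm]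
    · intro j _ hj
      rw [hρ, if_neg hj, mul_zero]
    · exact fun h => (h hi).elim
  rw [h0] at hsum
  have hre : HasSum (fun i => c i * (⟪e i, A (e i)⟫_ℂ).re) 0 := by
    simpa using Complex.hasSum_re hsum
  have hdiag : ∀ i, (⟪e i, A (e i)⟫_ℂ).re = 0 := fun i => by
    have h := congrFun ((hasSum_zero_iff_of_nonneg fun i =>
      mul_nonneg (hc0 i).le (hA.re_inner_nonneg_right (e i))).1 hre) i
    exact (mul_eq_zero.1 h).resolve_left (hc0 i).ne'
  have hAe : ∀ i, A (e i) = 0 := fun i => by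
    have h := hA.norm_inner_sq_le (A (e i)) (e i)
    rw [hdiag, mul_zero] at h
    exact inner_self_eq_zero.1 (norm_eq_zero.1 (pow_eq_zero_iff two_ne_zero |>.1
      (le_antisymm h (sq_nonneg _))))
  ext x
  have hx := (A.continuous.tendsto _).comp (tendsto_basisProj x)
  refine tendsto_nhds_unique hx (tendsto_const_nhds.congr fun F => ?_)
  simp [basisProj_apply, ← he, hAe]

end Matrix

/-! ### Responses of families of states, and responses on all bounded operators -/

section Measure

variable {H : Type u} [NormedAddCommGroup H] [InnerProductSpace ℂ H] [CompleteSpace H]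

/-- A null set of a faithful state has the zero effect, hence is null for every state. -/
theorem POVM.born_absolutelyContinuous {Ω : Type v} [MeasurableSpace Ω] (G : POVM Ω H)
    {ρ₀ : DensityOperator H} (h₀ : ρ₀.Faithful) (ρ : DensityOperator H) :
    G.born ρ ≪ G.born ρ₀ := by
  refine Measure.AbsolutelyContinuous.mk fun X hX h => ?_
  have h1 : G.effect X = 0 := by
    refine h₀ _ (G.isPositive X hX) ?_
    rw [G.expect_effect ρ₀ hX, measureReal_def, h]
    simp
  have h2 := G.expect_effect ρ hX
  rw [h1, ← DensityOperator.expectₗ_apply, map_zero, eq_comm, Complex.ofReal_eq_zero,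
    measureReal_eq_zero_iff] at h2
  exact h2

/-- The measurement response `A ↦ [ω ↦ tr(σ_ω A)]` of a weakly measurable family of states. -/
noncomputable def MeasurementResponse.ofStates {Ω : Type v} [MeasurableSpace Ω] (G : POVM Ω H)
    (ρ₀ : DensityOperator H) (σ : Ω → DensityOperator H)
    (hσ : ∀ A : H →L[ℂ] H, Measurable fun ω => (σ ω).expect A) : MeasurementResponse G ρ₀ :=
  have hmem : ∀ A, MemLp (fun ω => (σ ω).expect A) ∞ (G.born ρ₀) := fun A =>
    memLp_top_of_bound (hσ A).aestronglyMeasurable ‖A‖ (.of_forall fun ω => (σ ω).norm_expect_le A)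
  { toLinearMap :=
      { toFun := fun A => (hmem A).toLp _
        map_add' := fun A B => by
          rw [← MemLp.toLp_add]
          exact MemLp.toLp_congr _ _ (.of_forall fun ω => (σ ω).expect_add A B)
        map_smul' := fun c A => by
          rw [RingHom.id_apply, ← MemLp.toLp_const_smul]
          exact MemLp.toLp_congr _ _ (.of_forall fun ω => (σ ω).expect_smul c A) }
    positive := fun A hA => by
      filter_upwards [(hmem A).coeFn_toLp] with ω hω
      change 0 ≤ (hmem A).toLp _ ω
      rw [hω]
      exact (σ ω).expect_nonneg hA
    unital := by
      filter_upwards [(hmem (ContinuousLinearMap.id ℂ H)).coeFn_toLp] with ω hω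
      change (hmem (ContinuousLinearMap.id ℂ H)).toLp _ ω = 1
      rw [hω, (σ ω).expect_id] }

theorem MeasurementResponse.ofStates_ae_eq {Ω : Type v} [MeasurableSpace Ω] (G : POVM Ω H)
    (ρ₀ : DensityOperator H) (σ : Ω → DensityOperator H)
    (hσ : ∀ A : H →L[ℂ] H, Measurable fun ω => (σ ω).expect A) (A : H →L[ℂ] H) :
    (ofStates G ρ₀ σ hσ).toLinearMap A =ᵐ[G.born ρ₀] fun ω => (σ ω).expect A :=
  MemLp.coeFn_toLp (memLp_top_of_bound (hσ A).aestronglyMeasurable ‖A‖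
    (.of_forall fun ω => (σ ω).norm_expect_le A))

theorem NormalNonConfirming.nonNormal [TopologicalSpace.SeparableSpace H] [Nontrivial H]
    {S : Set (DensityOperator H)} (h : NormalNonConfirming.{u, v} S) :
    NonNormalNonConfirming.{u, v} S := by
  have := countable_basisIndex (H := H)
  obtain ⟨Ω, _, hΩ, G, σ, hσ, h⟩ := h
  obtain ⟨ρ₀, hρ₀⟩ := DensityOperator.exists_faithful (H := H)
  refine ⟨Ω, _, hΩ, G, ρ₀, hρ₀, .ofStates G ρ₀ σ hσ, fun ρ hρ Ω' _ _ M X hX => ?_⟩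
  rw [h ρ hρ Ω' M X hX]
  exact integral_congr_ae ((G.born_absolutelyContinuous hρ₀ ρ).ae_eq
    (MeasurementResponse.ofStates_ae_eq G ρ₀ σ hσ _)).symm

/-- The two-outcome measurement with effects `E` for `true` and `1 - E` for `false`. The outcomes
are lifted to the universe over which the definitions quantify. -/
noncomputable def POVM.ofEffect (E : H →L[ℂ] H) (hE : E.IsPositive)
    (hE' : (ContinuousLinearMap.id ℂ H - E).IsPositive) : POVM (ULift.{v} Bool) H where
  effect X := (Set.indicator X 1 (ULift.up true) : ℂ) • E +
    (Set.indicator X 1 (ULift.up false) : ℂ) • (ContinuousLinearMap.id ℂ H - E)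
  isPositive X _ := by
    have h : ∀ b, 0 ≤ (Set.indicator X 1 b : ℂ) := fun b =>
      Set.indicator_nonneg (fun _ _ => zero_le_one) b
    exact (hE.smul_of_nonneg (h _)).add (hE'.smul_of_nonneg (h _))
  exists_measure ρ := by
    have h1 := ρ.expect_nonneg hE
    have h2 := ρ.expect_nonneg hE'
    have h3 : ρ.expect E + ρ.expect (ContinuousLinearMap.id ℂ H - E) = 1 := by
      rw [← ρ.expect_add, add_sub_cancel, ρ.expect_id]
    set p := ρ.expect E
    set q := ρ.expect (ContinuousLinearMap.id ℂ H - E)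
    have hp : p = (p.re : ℂ) := Complex.eq_re_of_ofReal_le (r := 0) (by simpa using h1)
    have hq : q = (q.re : ℂ) := Complex.eq_re_of_ofReal_le (r := 0) (by simpa using h2)
    have hp0 : 0 ≤ p.re := (Complex.nonneg_iff.1 h1).1
    have hq0 : 0 ≤ q.re := (Complex.nonneg_iff.1 h2).1
    have hpq : p.re + q.re = 1 := by simpa using congrArg Complex.re h3
    refine ⟨ENNReal.ofReal p.re • Measure.dirac (ULift.up true) +
      ENNReal.ofReal q.re • Measure.dirac (ULift.up false), ⟨?_⟩, fun X hX => ?_⟩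
    · simp [← ENNReal.ofReal_add hp0 hq0, hpq]
    · rw [ρ.expect_add, ρ.expect_smul, ρ.expect_smul, measureReal_def]
      change _ * p + _ * q = _
      rw [hp, hq]
      by_cases ht : ULift.up true ∈ X <;> by_cases hf : ULift.up false ∈ X <;>
        simp [ht, hf, hX, hp0, hq0, ENNReal.toReal_add]

theorem POVM.ofEffect_effect (E : H →L[ℂ] H) (hE : E.IsPositive)
    (hE' : (ContinuousLinearMap.id ℂ H - E).IsPositive) :
    (ofEffect.{u, v} E hE hE').effect {ULift.up true} = E := by
  simp [ofEffect]

variable {Ω : Type v} [MeasurableSpace Ω] {G : POVM Ω H} {ρ₀ : DensityOperator H}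

theorem MeasurementResponse.integrable (T : MeasurementResponse G ρ₀) (h₀ : ρ₀.Faithful)
    (ρ : DensityOperator H) (A : H →L[ℂ] H) : Integrable (T.toLinearMap A) (G.born ρ) := by
  have hac := G.born_absolutelyContinuous h₀ ρ
  have h : MemLp (T.toLinearMap A) ∞ (G.born ρ₀) := Lp.memLp _
  have h2 : MemLp (T.toLinearMap A) ∞ (G.born ρ) :=
    ⟨h.1.mono_ac hac, by
      rw [eLpNorm_exponent_top]
      refine (essSup_mono_measure hac).trans_lt ?_
      have h3 := h.2
      rwa [eLpNorm_exponent_top] at h3⟩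
  exact (h2.mono_exponent le_top).integrable le_rfl

/-- Effects span the bounded operators, so a response that reproduces the probabilities of all
two-outcome measurements in the state `ρ` reproduces all expectation values. -/
theorem MeasurementResponse.expect_eq_integral (T : MeasurementResponse G ρ₀) (h₀ : ρ₀.Faithful)
    (ρ : DensityOperator H)
    (h : ∀ E : H →L[ℂ] H, E.IsPositive → (ContinuousLinearMap.id ℂ H - E).IsPositive →
      ρ.expect E = ∫ ω, T.toLinearMap E ω ∂(G.born ρ)) (A : H →L[ℂ] H) :
    ρ.expect A = ∫ ω, T.toLinearMap A ω ∂(G.born ρ) := by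
  have hac := G.born_absolutelyContinuous h₀ ρ
  have hsmul : ∀ (c : ℂ) (B : H →L[ℂ] H), ρ.expect B = ∫ ω, T.toLinearMap B ω ∂(G.born ρ) →
      ρ.expect (c • B) = ∫ ω, T.toLinearMap (c • B) ω ∂(G.born ρ) := by
    intro c B hB
    rw [ρ.expect_smul, hB, ← integral_const_mul, map_smul]
    refine integral_congr_ae ?_
    filter_upwards [hac.ae_eq (Lp.coeFn_smul c (T.toLinearMap B))] with ω hω
    rw [hω, Pi.smul_apply, smul_eq_mul]
  have hmem : A ∈ Submodule.span ℂ ({B : H →L[ℂ] H | 0 ≤ B} ∩ Metric.closedBall 0 1) := by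
    rw [CStarAlgebra.span_nonneg_inter_unitClosedBall]
    trivial
  induction hmem using Submodule.span_induction with
  | mem B hB =>
    refine h B ((ContinuousLinearMap.nonneg_iff_isPositive B).1 hB.1) ?_
    exact (ContinuousLinearMap.le_def _ _).1
      ((CStarAlgebra.norm_le_one_iff_of_nonneg B hB.1).1 (mem_closedBall_zero_iff.1 hB.2))
  | zero =>
    rw [← DensityOperator.expectₗ_apply, map_zero, map_zero, eq_comm]
    exact integral_eq_zero_of_ae (hac.ae_eq (Lp.coeFn_zero ℂ ∞ (G.born ρ₀)))
  | add B C _ _ hB hC =>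
    rw [ρ.expect_add, hB, hC, ← integral_add (T.integrable h₀ ρ B) (T.integrable h₀ ρ C), map_add]
    refine integral_congr_ae ?_
    filter_upwards [hac.ae_eq (Lp.coeFn_add (T.toLinearMap B) (T.toLinearMap C))] with ω hω
    rw [hω, Pi.add_apply]
  | smul c B _ hB => exact hsmul c B hB

end Measure

/-! ### The normal part of a response -/

section NormalPart

variable {H : Type u} [NormedAddCommGroup H] [InnerProductSpace ℂ H] [CompleteSpace H]

theorem measurable_expect_of_entries [Countable (basisIndex H)] {Ω : Type v} [MeasurableSpace Ω]
    {σ : Ω → DensityOperator H}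
    (hσ : ∀ i j, Measurable fun ω => ⟪fixedBasis H i, (σ ω).op (fixedBasis H j)⟫_ℂ)
    (A : H →L[ℂ] H) : Measurable fun ω => (σ ω).expect A := by
  refine measurable_of_tendsto_metrizable' (atTop : Filter (Finset (basisIndex H)))
    (f := fun F ω => (σ ω).expect (compression F A)) (fun F => ?_)
    (tendsto_pi_nhds.2 fun ω => (σ ω).tendsto_expect_compression A)
  simp only [DensityOperator.expect_compression]
  exact Finset.measurable_fun_sum _ fun i _ => Finset.measurable_fun_sum _ fun j _ =>
    (hσ j i).const_mul _

variable {Ω : Type v} [MeasurableSpace Ω] {G : POVM Ω H} {ρ₀ : DensityOperator H}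

namespace MeasurementResponse

theorem apply_add (T : MeasurementResponse G ρ₀) (A B : H →L[ℂ] H) :
    ∀ᵐ ω ∂(G.born ρ₀), T.toLinearMap (A + B) ω = T.toLinearMap A ω + T.toLinearMap B ω := by
  rw [map_add]
  exact Lp.coeFn_add _ _

theorem apply_smul (T : MeasurementResponse G ρ₀) (c : ℂ) (A : H →L[ℂ] H) :
    ∀ᵐ ω ∂(G.born ρ₀), T.toLinearMap (c • A) ω = c * T.toLinearMap A ω := by
  rw [map_smul]
  exact Lp.coeFn_smul _ _

theorem apply_sum (T : MeasurementResponse G ρ₀) {κ : Type*} (s : Finset κ) (A : κ → H →L[ℂ] H) :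
    ∀ᵐ ω ∂(G.born ρ₀), T.toLinearMap (∑ k ∈ s, A k) ω = ∑ k ∈ s, T.toLinearMap (A k) ω := by
  classical
  induction s using Finset.induction_on with
  | empty =>
    rw [Finset.sum_empty, map_zero]
    exact Lp.coeFn_zero _ _ _
  | insert k s hk ih =>
    simp only [Finset.sum_insert hk]
    filter_upwards [ih, T.apply_add (A k) (∑ k ∈ s, A k)] with ω h1 h2
    rw [h2, h1]

/-- The matrix entry of the response at `ω`, meant to be `⟪eᵢ, σ_ω eⱼ⟫ = tr(σ_ω |eⱼ⟩⟨eᵢ|)`. It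
depends on the representatives of countably many elements of `L^∞`. -/
noncomputable def entry (T : MeasurementResponse G ρ₀) (ω : Ω) (i j : basisIndex H) : ℂ :=
  T.toLinearMap (rankOne ℂ (fixedBasis H j) (fixedBasis H i)) ω

theorem measurable_entry (T : MeasurementResponse G ρ₀) (i j : basisIndex H) :
    Measurable fun ω => T.entry ω i j :=
  (Lp.stronglyMeasurable _).measurable

theorem apply_compression (T : MeasurementResponse G ρ₀) (F : Finset (basisIndex H))
    (A : H →L[ℂ] H) : ∀ᵐ ω ∂(G.born ρ₀), T.toLinearMap (compression F A) ω =
      ∑ i ∈ F, ∑ j ∈ F, ⟪fixedBasis H i, A (fixedBasis H j)⟫_ℂ * T.entry ω j i := by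
  rw [compression_eq_sum, ← Finset.sum_product']
  have h : ∀ p ∈ F ×ˢ F, ∀ᵐ ω ∂(G.born ρ₀),
      T.toLinearMap (⟪fixedBasis H p.1, A (fixedBasis H p.2)⟫_ℂ •
        rankOne ℂ (fixedBasis H p.1) (fixedBasis H p.2)) ω =
      ⟪fixedBasis H p.1, A (fixedBasis H p.2)⟫_ℂ * T.entry ω p.2 p.1 := fun p _ =>
    T.apply_smul _ _
  filter_upwards [T.apply_sum (F ×ˢ F) fun p => ⟪fixedBasis H p.1, A (fixedBasis H p.2)⟫_ℂ •
    rankOne ℂ (fixedBasis H p.1) (fixedBasis H p.2), (Finset.eventually_all _).2 h] with ω h1 h2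
  rw [h1, ← Finset.sum_product']
  exact Finset.sum_congr rfl h2

/-- Positivity of the response makes almost all of its matrices positive semidefinite. Only
countably many vectors have to be tested, since the quadratic forms are continuous. -/
theorem ae_isPositive_matrixTruncation [TopologicalSpace.SeparableSpace H]
    [Countable (basisIndex H)] (T : MeasurementResponse G ρ₀) :
    ∀ᵐ ω ∂(G.born ρ₀), ∀ F, (matrixTruncation (T.entry ω) F).IsPositive := by
  have h : ∀ (F : Finset (basisIndex H)) (n : ℕ), ∀ᵐ ω ∂(G.born ρ₀),
      0 ≤ ⟪TopologicalSpace.denseSeq H n,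
        matrixTruncation (T.entry ω) F (TopologicalSpace.denseSeq H n)⟫_ℂ := by
    intro F n
    set x := TopologicalSpace.denseSeq H n
    have hpos : (compression F (rankOne ℂ x x)).IsPositive := by
      have := (isPositive_rankOne_self (𝕜 := ℂ) x).conj_adjoint (basisProj F)
      rwa [(isPositive_basisProj F).isSelfAdjoint.adjoint_eq] at this
    filter_upwards [T.positive _ hpos, T.apply_compression F (rankOne ℂ x x)] with ω h1 h2
    rw [h2] at h1
    convert h1 using 1
    rw [inner_matrixTruncation, Finset.sum_comm]
    refine Finset.sum_congr rfl fun i _ => Finset.sum_congr rfl fun j _ => ?_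
    rw [rankOne_apply, inner_smul_right]
    ring
  filter_upwards [ae_all_iff.2 fun F => ae_all_iff.2 (h F)] with ω hω F
  refine ContinuousLinearMap.isPositive_of_inner_nonneg fun x => ?_
  refine (TopologicalSpace.denseRange_denseSeq H).induction_on x ?_ (hω F)
  exact isClosed_le continuous_const
    (continuous_id.inner (matrixTruncation (T.entry ω) F).continuous)

theorem ae_entry_nonneg [Countable (basisIndex H)] (T : MeasurementResponse G ρ₀) :
    ∀ᵐ ω ∂(G.born ρ₀), ∀ i, 0 ≤ T.entry ω i i :=
  ae_all_iff.2 fun _ => T.positive _ (isPositive_rankOne_self _)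

theorem measurable_ofReal_re_entry (T : MeasurementResponse G ρ₀) (i j : basisIndex H) :
    Measurable fun ω => ENNReal.ofReal (T.entry ω i j).re :=
  (Complex.measurable_re.comp (T.measurable_entry i j)).ennreal_ofReal

/-- The trace of the normal part of the response at `ω`, as a sum in `[0, ∞]`; it is the sum of
the diagonal entries wherever these are nonnegative. -/
noncomputable def normalMass (T : MeasurementResponse G ρ₀) (ω : Ω) : ℝ≥0∞ :=
  ∑' i, ENNReal.ofReal (T.entry ω i i).re

theorem measurable_normalMass [Countable (basisIndex H)] (T : MeasurementResponse G ρ₀) :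
    Measurable T.normalMass :=
  Measurable.tsum fun i => T.measurable_ofReal_re_entry i i

theorem ae_normalMass_le_one [Countable (basisIndex H)] (T : MeasurementResponse G ρ₀) :
    ∀ᵐ ω ∂(G.born ρ₀), T.normalMass ω ≤ 1 := by
  have h : ∀ F : Finset (basisIndex H), ∀ᵐ ω ∂(G.born ρ₀), (∑ i ∈ F, T.entry ω i i).re ≤ 1 := by
    intro F
    filter_upwards [T.positive _ (isPositive_id_sub_basisProj F), T.unital,
      T.apply_add (ContinuousLinearMap.id ℂ H - basisProj F) (basisProj F),
      T.apply_sum F fun i => rankOne ℂ (fixedBasis H i) (fixedBasis H i)] with ω h1 h2 h3 h4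
    rw [sub_add_cancel, h2] at h3
    have h5 := (Complex.nonneg_iff.1 h1).1
    have h6 := congrArg Complex.re h3
    rw [Complex.add_re, Complex.one_re] at h6
    change T.toLinearMap (basisProj F) ω = ∑ i ∈ F, T.entry ω i i at h4
    rw [← h4]
    linarith
  filter_upwards [ae_all_iff.2 h, T.ae_entry_nonneg] with ω h1 h2
  rw [normalMass, ENNReal.tsum_eq_iSup_sum]
  refine iSup_le fun F => ?_
  rw [← ENNReal.ofReal_sum_of_nonneg fun i _ => (Complex.nonneg_iff.1 (h2 i)).1,
    ← Complex.re_sum]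
  exact ENNReal.ofReal_le_one.2 (h1 F)

/-- A state `ρ` whose expectation values the response reproduces does not see the singular part of
the response: the mass of the normal part is at most `1` and integrates to `∑ᵢ ⟪eᵢ, ρ eᵢ⟫ = 1`. -/
theorem ae_normalMass_eq_one [Countable (basisIndex H)] (T : MeasurementResponse G ρ₀)
    (h₀ : ρ₀.Faithful) {ρ : DensityOperator H}
    (h : ∀ A : H →L[ℂ] H, ρ.expect A = ∫ ω, T.toLinearMap A ω ∂(G.born ρ)) :
    ∀ᵐ ω ∂(G.born ρ), T.normalMass ω = 1 := by
  have hac := G.born_absolutelyContinuous h₀ ρ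
  have hint : ∫⁻ ω, T.normalMass ω ∂(G.born ρ) = 1 := by
    unfold normalMass
    rw [lintegral_tsum fun i => (T.measurable_ofReal_re_entry i i).aemeasurable]
    have h1 : ∀ i, ∫⁻ ω, ENNReal.ofReal (T.entry ω i i).re ∂(G.born ρ) =
        ENNReal.ofReal (⟪fixedBasis H i, ρ.op (fixedBasis H i)⟫_ℂ).re := by
      intro i
      have hi : Integrable (fun ω => T.entry ω i i) (G.born ρ) := T.integrable h₀ ρ _
      have hire : Integrable (fun ω => (T.entry ω i i).re) (G.born ρ) := hi.re
      rw [← ofReal_integral_eq_lintegral_ofReal hire, ← ρ.expect_rankOne, h]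
      · congr 1
        exact integral_re hi
      · filter_upwards [hac.ae_le T.ae_entry_nonneg] with ω hω
        exact (Complex.nonneg_iff.1 (hω i)).1
    have htr : HasSum (fun i => (⟪fixedBasis H i, ρ.op (fixedBasis H i)⟫_ℂ).re) 1 := by
      simpa using Complex.hasSum_re ρ.trace_one
    have hnn : ∀ i, 0 ≤ (⟪fixedBasis H i, ρ.op (fixedBasis H i)⟫_ℂ).re := fun i =>
      ρ.isPositive.re_inner_nonneg_right _
    simp only [h1]
    rw [← ENNReal.ofReal_tsum_of_nonneg hnn htr.summable, htr.tsum_eq, ENNReal.ofReal_one]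
  refine ae_eq_of_ae_le_of_lintegral_le (hac.ae_le T.ae_normalMass_le_one) (by simp [hint])
    aemeasurable_const ?_
  simp [hint]

/-- Where the matrix of the response is positive semidefinite of trace one, it is the matrix of a
state; elsewhere `ρ₀` serves as a dummy value. Discarding a measurable null set instead of the
exact set of bad points keeps the family measurable. -/
theorem exists_states [TopologicalSpace.SeparableSpace H] [Countable (basisIndex H)]
    (T : MeasurementResponse G ρ₀) :
    ∃ σ : Ω → DensityOperator H, (∀ A : H →L[ℂ] H, Measurable fun ω => (σ ω).expect A) ∧
      ∀ᵐ ω ∂(G.born ρ₀), T.normalMass ω = 1 →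
        ∀ i j, ⟪fixedBasis H i, (σ ω).op (fixedBasis H j)⟫_ℂ = T.entry ω i j := by
  classical
  set N := toMeasurable (G.born ρ₀) {ω | ¬ ∀ F, (matrixTruncation (T.entry ω) F).IsPositive}
  have hN : G.born ρ₀ N = 0 := by
    rw [measure_toMeasurable]
    exact ae_iff.1 T.ae_isPositive_matrixTruncation
  set good : Set Ω := Nᶜ ∩ {ω | T.normalMass ω = 1}
  have hgood : MeasurableSet good := (measurableSet_toMeasurable _ _).compl.inter
    (T.measurable_normalMass (measurableSet_singleton 1))
  have hex : ∀ ω, ∃ σ : DensityOperator H, ∀ i j,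
      ⟪fixedBasis H i, σ.op (fixedBasis H j)⟫_ℂ =
        if ω ∈ good then T.entry ω i j else ⟪fixedBasis H i, ρ₀.op (fixedBasis H j)⟫_ℂ := by
    intro ω
    by_cases hω : ω ∈ good
    · have hpos : ∀ F, (matrixTruncation (T.entry ω) F).IsPositive := by
        by_contra hc
        exact hω.1 (subset_toMeasurable _ _ hc)
      have hdiag : ∀ i, 0 ≤ T.entry ω i i := fun i => by
        rw [← inner_matrixTruncation_basis (T.entry ω) (Finset.mem_singleton_self i)
          (Finset.mem_singleton_self i)]
        exact (hpos {i}).inner_nonneg_right _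
      have hmass : ∑' i, ENNReal.ofReal (T.entry ω i i).re = 1 := hω.2
      have htr : HasSum (fun i => T.entry ω i i) 1 := by
        have h1 := ENNReal.hasSum_toReal (hmass.trans_ne ENNReal.one_ne_top)
        rw [← ENNReal.tsum_toReal_eq fun i => ENNReal.ofReal_ne_top, hmass,
          ENNReal.toReal_one] at h1
        have h2 := Complex.hasSum_ofReal.2 h1
        rw [Complex.ofReal_one] at h2
        refine h2.congr_fun fun i => ?_
        obtain ⟨h3, h4⟩ := Complex.nonneg_iff.1 (hdiag i)
        rw [ENNReal.toReal_ofReal h3]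
        exact Complex.ext rfl h4.symm
      obtain ⟨σ, hσ⟩ := exists_densityOperator_of_matrix (T.entry ω) hpos htr
      exact ⟨σ, fun i j => by rw [hσ, if_pos hω]⟩
    · exact ⟨ρ₀, fun i j => by rw [if_neg hω]⟩
  choose σ hσ using hex
  refine ⟨σ, measurable_expect_of_entries fun i j => ?_, ?_⟩
  · simp only [hσ]
    exact Measurable.ite hgood (T.measurable_entry i j) measurable_const
  · filter_upwards [measure_eq_zero_iff_ae_notMem.1 hN] with ω hω hmass i j
    rw [hσ, if_pos ⟨hω, hmass⟩]

end MeasurementResponse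

theorem NonNormalNonConfirming.normal [TopologicalSpace.SeparableSpace H]
    {S : Set (DensityOperator H)} (h : NonNormalNonConfirming.{u, v} S) :
    NormalNonConfirming.{u, v} S := by
  have := countable_basisIndex (H := H)
  obtain ⟨Ω, _, hΩ, G, ρ₀, hρ₀, T, h⟩ := h
  obtain ⟨σ, hσm, hσ⟩ := T.exists_states
  refine ⟨Ω, _, hΩ, G, σ, hσm, fun ρ hρ Ω' _ _ M X _ => ?_⟩
  have hac := G.born_absolutelyContinuous hρ₀ ρ
  have hT := T.expect_eq_integral hρ₀ ρ fun E hE hE' => by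
    have := h ρ hρ _ (POVM.ofEffect.{u, v} E hE hE') {ULift.up true} (measurableSet_singleton _)
    rwa [POVM.ofEffect_effect] at this
  set A := M.effect X
  -- Both sides are limits of their values at the finite-rank compressions of `A`, where they agree.
  have h1 : ∀ F, ρ.expect (compression F A) = ∫ ω, (σ ω).expect (compression F A) ∂(G.born ρ) := by
    intro F
    rw [hT]
    refine integral_congr_ae ?_
    filter_upwards [hac.ae_le hσ, T.ae_normalMass_eq_one hρ₀ hT,
      hac.ae_le (T.apply_compression F A)] with ω h2 h3 h4
    rw [h4, (σ ω).expect_compression]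
    simp only [h2 h3]
  refine tendsto_nhds_unique (ρ.tendsto_expect_compression A) ?_
  simp only [h1]
  refine tendsto_integral_filter_of_dominated_convergence (fun _ => ‖A‖)
    (.of_forall fun F => (hσm _).aestronglyMeasurable)
    (.of_forall fun F => .of_forall fun ω => ((σ ω).norm_expect_le _).trans
      (norm_compression_le F A)) (integrable_const _)
    (.of_forall fun ω => (σ ω).tendsto_expect_compression A)

end NormalPart

theorem mainTheorem9 {H : Type u} [NormedAddCommGroup H] [InnerProductSpace ℂ H]
    [CompleteSpace H] [TopologicalSpace.SeparableSpace H] [Nontrivial H]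
    (S : Set (DensityOperator H)) :
    NormalNonConfirming.{u, v} S ↔ NonNormalNonConfirming.{u, v} S :=
  ⟨NormalNonConfirming.nonNormal, NonNormalNonConfirming.normal⟩
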